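/- For a number field $E$ and a rational prime $p$, the arithmetic type $A_p(E)=(f_1,\dots,f_g)$, $f_1\le\dots\le f_g$, is the tuple of the residue class degrees of the distinct primes of $\mathcal O_E$ above $p$. For number fields $K,L$ let $$A_{K,L}=\{p \text{ prime} : A_p(K)=A_p(L),\ p \text{ ramifies neither in } K \text{ nor in } L\}.$$ For a set $S$ of rational primes let $$\delta(S)=\lim_{s\to1^+}\frac{\sum_{p\in S}p^{-s}}{\sum_{p}p^{-s}}$$ denote its Dirichlet density, when the limit exists. Two number fields are called arithmetically equivalent if they have the same Dedekind zeta function. Theorem. Let $\ell$ be a prime and let $K,L$ be number fields of degree $\ell$ that are Galois over $\mathbb Q$. Then the Dirichlet density $\delta(A_{K,L})$ exists, and 1. if $\delta(A_{K,L})>1-\frac{2}{\ell^2}$, then $K$ and $L$ are arithmetically equivalent; 2. if $\ell=2$ and $\delta(A_{K,L})=1-\frac{2}{2^2}=\frac12$, then $K$ and $L$ are not arithmetically equivalent. -/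

import Mathlib

namespace ArithEquiv

open NumberField

/-- Two number fields are arithmetically equivalent if they have the same Dedekind zeta function.
The zeta functions are compared on the half-plane `1 < re s`, where the Dirichlet series
`NumberField.dedekindZeta` converges; their meromorphic continuations to `ℂ` agree if and only if
they agree there. -/
def ArithmeticallyEquivalent (K L : Type*) [Field K] [NumberField K] [Field L] [NumberField L] :
    Prop :=
  ∀ s : ℂ, 1 < s.re → dedekindZeta K s = dedekindZeta L s

/-- The arithmetic type of a rational prime `p` in `K`: the tuple `(f₁, …, f_g)`, sorted so that
`f₁ ≤ ⋯ ≤ f_g`, of the residue class degrees of the `g` distinct primes of `𝓞 K` above `p`. -/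
noncomputable def arithmeticType (K : Type*) [Field K] [NumberField K] (p : ℕ) : List ℕ :=
  ((IsDedekindDomain.primesOverFinset (Ideal.span {(p : ℤ)}) (𝓞 K)).val.map
    fun P => P.inertiaDeg ℤ).sort (· ≤ ·)

/-- The set `A_{K,L}` of rational primes `p` that have the same arithmetic type in `K` and `L` and
ramify neither in `K` nor in `L` (equivalently, are unramified in a compositum of `K` and `L`). -/
def sameTypePrimes (K L : Type*) [Field K] [NumberField K] [Field L] [NumberField L] : Set ℕ :=
  {p | p.Prime ∧ arithmeticType K p = arithmeticType L p ∧
    Algebra.IsUnramifiedIn (𝓞 K) (Ideal.span {(p : ℤ)}) ∧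
    Algebra.IsUnramifiedIn (𝓞 L) (Ideal.span {(p : ℤ)})}

/-- A set of rational primes, viewed as a set of nonzero prime ideals of `𝓞 ℚ`: the prime number
corresponding to a nonzero prime ideal of `𝓞 ℚ` is its absolute norm. -/
def primeIdealsOf (S : Set ℕ) : Set (IsDedekindDomain.HeightOneSpectrum (𝓞 ℚ)) :=
  {v | Ideal.absNorm v.asIdeal ∈ S}

/-- The set `S` of rational primes has Dirichlet density `δ`, that is,
`(∑ p ∈ S, p ^ (-s)) / (∑ p, p ^ (-s))` tends to `δ` as `s → 1⁺`. -/
def HasDirichletDensity (S : Set ℕ) (δ : ℝ) : Prop :=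
  NumberField.Set.HasDirichletDensity (primeIdealsOf S) δ

end ArithEquiv

/-! In a Galois field of prime degree `ℓ` an unramified prime either splits completely or is inert,
so `p` has equal types in `K` and `L` exactly when it splits completely in both or in neither. The
density sought is therefore `1 - 1/ℓ - 1/ℓ + 2γ`, with `γ` the density of the primes split in both,
that is, split in a compositum `M`; hence `γ = 1/[M:ℚ]`. If `K` and `L` are not isomorphic, then
`[M:ℚ] = ℓ²` and the density is at most `1 - 2/ℓ²` because `ℓ ≥ 2`. Above this bound the fields are
isomorphic and share their zeta function. Conversely, the zeta function determines which unramified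
primes split, so arithmetic equivalence forces density `1`, never `1/2`.

Chebotarev is not needed: the density `1/n` of split primes (`tendsto_primeSum_splitPrimes`) follows
from the simple pole of the Dedekind zeta function at `1`. The other main inputs are
`mem_splitPrimes_compositum_iff` and `exists_galois_compositum`. -/

open Filter Topology NumberField IsDedekindDomain nonZeroDivisors Module

universe u

namespace ArithEquiv

/-! ### Prime ideal sums and the pole of the Dedekind zeta function -/

section EulerProduct

variable (F : Type*) [Field F] [NumberField F]

/-- The Dirichlet coefficients of the Dedekind zeta function: the number of ideals of norm `n`. -/
noncomputable def idealCount (n : ℕ) : ℕ := Nat.card {I : Ideal (𝓞 F) // Ideal.absNorm I = n}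

/-- The Dedekind zeta function at a real argument, as a sum over ideals. -/
noncomputable def idealZeta (s : ℝ) : ℝ := ∑' I : Ideal (𝓞 F), (Ideal.absNorm I : ℝ) ^ (-s)

/-- The sum of `N P ^ (-s)` over the nonzero primes `P` of `𝓞 F`. -/
noncomputable def primeZeta (s : ℝ) : ℝ :=
  ∑' P : HeightOneSpectrum (𝓞 F), (Ideal.absNorm P.asIdeal : ℝ) ^ (-s)

/-- The number of nonzero ideals of norm at most `n` grows linearly, so the partial sums of the
coefficients are `O(n)`. -/
theorem lseriesSummable_idealCount {s : ℂ} (hs : 1 < s.re) :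
    LSeriesSummable (fun n ↦ (idealCount F n : ℂ)) s := by
  have key : Tendsto (fun n : ℕ ↦ (∑ k ∈ Finset.Icc 1 n, (idealCount F k : ℝ)) / (n : ℝ)) atTop
      (𝓝 (dedekindZeta_residue F)) := by
    refine ((Ideal.tendsto_norm_le_div_atTop₀ F).comp tendsto_natCast_atTop_atTop).congr fun n ↦ ?_
    simp only [Function.comp_apply, Nat.cast_le, ← Nat.cast_sum, idealCount]
    congr
    -- The added `1` counts the zero ideal, the only one of norm `0`.
    rw [← add_left_inj 1, ← Ideal.card_norm_le_eq_card_norm_le_add_one,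
      show Finset.Icc 1 n = Finset.Ioc 0 n from Finset.Icc_succ_left_eq_Ioc _ _,
      show 1 = Nat.card {I : Ideal (𝓞 F) // Ideal.absNorm I = 0} by
        simp [Ideal.absNorm_eq_zero_iff],
      Finset.sum_Ioc_add_eq_sum_Icc (n.zero_le),
      ← Finset.card_preimage_eq_sum_card_image_eq
        (fun k _ ↦ Ideal.finite_setOfPred_absNorm_eq k)]
    simp [Set.coe_eq_subtype]
  have hO : (fun n : ℕ ↦ ∑ k ∈ Finset.Icc 1 n, (idealCount F k : ℝ)) =O[atTop]
      fun n ↦ (n : ℝ) ^ (1 : ℝ) := by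
    refine Asymptotics.isBigO_of_div_tendsto_nhds ?_ _ (key.congr fun n ↦ ?_)
    · filter_upwards [eventually_ne_atTop 0] with n hn h
      simp [hn] at h
    · simp
  simpa using LSeriesSummable_of_sum_norm_bigO_and_nonneg hO (fun _ ↦ Nat.cast_nonneg _)
    zero_le_one hs

theorem term_idealCount {s : ℝ} (hs : 1 < s) (n : ℕ) :
    LSeries.term (fun n ↦ (idealCount F n : ℂ)) s n =
      ((idealCount F n * (n : ℝ) ^ (-s) : ℝ) : ℂ) := by
  rcases eq_or_ne n 0 with rfl | hn
  -- The zero ideal is harmless: `0 ^ (-s) = 0` by convention.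
  · simp [Real.zero_rpow (show -s ≠ 0 by linarith)]
  · rw [LSeries.term_of_ne_zero hn]
    push_cast
    rw [Complex.ofReal_cpow (by positivity), Complex.ofReal_neg, Complex.cpow_neg, div_eq_mul_inv]
    simp

theorem hasSum_fiber_absNorm (s : ℝ) (n : ℕ) :
    HasSum (fun I : {I : Ideal (𝓞 F) // Ideal.absNorm I = n} ↦ (Ideal.absNorm I.1 : ℝ) ^ (-s))
      (idealCount F n * (n : ℝ) ^ (-s)) := by
  have : Finite {I : Ideal (𝓞 F) // Ideal.absNorm I = n} := Ideal.finite_setOfPred_absNorm_eq n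
  have := Fintype.ofFinite {I : Ideal (𝓞 F) // Ideal.absNorm I = n}
  have h := hasSum_fintype fun I : {I : Ideal (𝓞 F) // Ideal.absNorm I = n} ↦
    (Ideal.absNorm I.1 : ℝ) ^ (-s)
  rw [Finset.sum_congr rfl (g := fun _ ↦ (n : ℝ) ^ (-s)) (fun I _ ↦ by rw [I.2])] at h
  simpa [idealCount] using h

theorem summable_idealCount {s : ℝ} (hs : 1 < s) :
    Summable fun n : ℕ ↦ (idealCount F n * (n : ℝ) ^ (-s) : ℝ) := by
  have := lseriesSummable_idealCount F (s := s) (by simpa)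
  rw [LSeriesSummable, funext (term_idealCount F hs)] at this
  exact_mod_cast this

theorem summable_absNorm {s : ℝ} (hs : 1 < s) :
    Summable fun I : Ideal (𝓞 F) ↦ (Ideal.absNorm I : ℝ) ^ (-s) := by
  rw [← (Equiv.sigmaFiberEquiv (fun I : Ideal (𝓞 F) ↦ Ideal.absNorm I)).summable_iff,
    summable_sigma_of_nonneg (fun _ ↦ by simp only [Function.comp_apply]; positivity)]
  refine ⟨fun n ↦ (hasSum_fiber_absNorm F s n).summable, ?_⟩
  exact (summable_idealCount F hs).congr fun n ↦ ((hasSum_fiber_absNorm F s n).tsum_eq).symm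

theorem dedekindZeta_ofReal {s : ℝ} (hs : 1 < s) : dedekindZeta F s = idealZeta F s := by
  have h1 := (Equiv.sigmaFiberEquiv (fun I : Ideal (𝓞 F) ↦ Ideal.absNorm I)).hasSum_iff.mpr
    (summable_absNorm F hs).hasSum
  have h2 := h1.sigma (hasSum_fiber_absNorm F s)
  rw [idealZeta, ← h2.tsum_eq, Complex.ofReal_tsum]
  exact tsum_congr (term_idealCount F hs)

theorem tendsto_sub_one_mul_idealZeta :
    Tendsto (fun s : ℝ ↦ (s - 1) * idealZeta F s) (𝓝[>] 1) (𝓝 (dedekindZeta_residue F)) := by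
  have := tendsto_sub_one_mul_dedekindZeta_nhdsGT F
  refine Filter.tendsto_ofReal_iff.mp ?_
  refine this.congr' ?_
  filter_upwards [self_mem_nhdsWithin] with s hs
  rw [dedekindZeta_ofReal F hs]
  simp

variable {F}

theorem primeZeta_summable {s : ℝ} (hs : 1 < s) :
    Summable fun P : HeightOneSpectrum (𝓞 F) ↦ (Ideal.absNorm P.asIdeal : ℝ) ^ (-s) :=
  (summable_absNorm F hs).comp_injective (i := fun P : HeightOneSpectrum (𝓞 F) ↦ P.asIdeal)
    fun _ _ h ↦ HeightOneSpectrum.ext h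

/-- `T` is recovered as the set of primes dividing the product. -/
theorem prod_asIdeal_injective :
    Function.Injective fun T : Finset (HeightOneSpectrum (𝓞 F)) ↦ ∏ P ∈ T, P.asIdeal := by
  have key (T : Finset (HeightOneSpectrum (𝓞 F))) (P) : P ∈ T ↔ P.asIdeal ∣ ∏ P ∈ T, P.asIdeal := by
    refine ⟨fun h ↦ Finset.dvd_prod_of_mem _ h, fun h ↦ ?_⟩
    obtain ⟨Q, hQ, hPQ⟩ := (P.prime.dvd_finsetProd_iff _).mp h
    have : P = Q := HeightOneSpectrum.ext
      (((Q.isMaximal).eq_of_le P.isPrime.ne_top (Ideal.dvd_iff_le.mp hPQ)).symm)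
    rwa [this]
  intro T T' h
  ext P
  rw [key, key]
  exact iff_of_eq (congrArg (P.asIdeal ∣ ·) h)

theorem absNorm_prod_rpow (s : ℝ) (T : Finset (HeightOneSpectrum (𝓞 F))) :
    (Ideal.absNorm (∏ P ∈ T, P.asIdeal) : ℝ) ^ (-s) =
      ∏ P ∈ T, (Ideal.absNorm P.asIdeal : ℝ) ^ (-s) := by
  rw [map_prod, Nat.cast_prod, Real.finsetProd_rpow _ _ (fun _ _ ↦ by positivity)]

/-- Induction on prime factors: a new factor joins `T`, or, if it is already there, the two copies
move into `J`. -/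
theorem exists_sq_mul_prod (I : Ideal (𝓞 F)) :
    ∃ J : Ideal (𝓞 F), ∃ T : Finset (HeightOneSpectrum (𝓞 F)), I = J ^ 2 * ∏ P ∈ T, P.asIdeal := by
  classical
  refine UniqueFactorizationMonoid.induction_on_prime I ⟨0, ∅, by simp⟩
    (fun I hI ↦ ⟨1, ∅, by
      rw [Ideal.isUnit_iff.mp hI, ← Ideal.one_eq_top, one_pow, Finset.prod_empty, one_mul]⟩) ?_
  rintro I p - hp ⟨J, T, rfl⟩
  set P : HeightOneSpectrum (𝓞 F) := .ofPrime hp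
  have hP : P.asIdeal = p := rfl
  by_cases h : P ∈ T
  · refine ⟨p * J, T.erase P, ?_⟩
    rw [← Finset.mul_prod_erase _ _ h, hP]
    ring
  · refine ⟨J, insert P T, ?_⟩
    rw [Finset.prod_insert h, hP]
    ring

theorem summable_prod_absNorm {s : ℝ} (hs : 1 < s) :
    Summable fun T : Finset (HeightOneSpectrum (𝓞 F)) ↦
      ∏ P ∈ T, (Ideal.absNorm P.asIdeal : ℝ) ^ (-s) :=
  summable_finsetProd_of_summable_nonneg (fun _ ↦ by positivity) (primeZeta_summable hs)

/-- Expanding the product gives the part of the zeta sum over squarefree ideals. -/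
theorem tprod_one_add_le_idealZeta {s : ℝ} (hs : 1 < s) :
    ∏' P : HeightOneSpectrum (𝓞 F), (1 + (Ideal.absNorm P.asIdeal : ℝ) ^ (-s)) ≤
      idealZeta F s := by
  rw [tprod_one_add (summable_prod_absNorm hs)]
  simp_rw [← absNorm_prod_rpow]
  exact tsum_comp_le_tsum_of_inj (summable_absNorm F hs) (fun _ ↦ by positivity)
    prod_asIdeal_injective

/-- Writing each ideal as a square times a squarefree ideal embeds the zeta sum in the double sum;
the squares account for the argument `2 * s`. -/
theorem idealZeta_le_mul_tprod {s : ℝ} (hs : 1 < s) :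
    idealZeta F s ≤ idealZeta F (2 * s) *
      ∏' P : HeightOneSpectrum (𝓞 F), (1 + (Ideal.absNorm P.asIdeal : ℝ) ^ (-s)) := by
  have h2 : 1 < 2 * s := by linarith
  have hmul := (summable_absNorm F h2).mul_of_nonneg (summable_prod_absNorm (F := F) hs)
    (fun _ ↦ by positivity) (fun _ ↦ by positivity)
  rw [tprod_one_add (summable_prod_absNorm hs), idealZeta, idealZeta,
    (summable_absNorm F h2).tsum_mul_tsum (summable_prod_absNorm hs) hmul]
  choose J T hJT using exists_sq_mul_prod (F := F)
  refine Summable.tsum_le_tsum_of_inj (fun I ↦ (J I, T I)) (fun I I' h ↦ ?_)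
    (fun _ _ ↦ by positivity) (fun I ↦ ?_) (summable_absNorm F hs) hmul
  · obtain ⟨h1, h2⟩ := Prod.mk.inj h
    rw [hJT I, hJT I', h1, h2]
  · conv_lhs => rw [hJT I]
    rw [map_mul, map_pow, Nat.cast_mul, Nat.cast_pow, Real.mul_rpow (by positivity) (by positivity),
      absNorm_prod_rpow, ← Real.rpow_natCast, ← Real.rpow_mul (by positivity)]
    exact le_of_eq (by congr 2; push_cast; ring)

theorem one_le_absNorm_asIdeal (P : HeightOneSpectrum (𝓞 F)) :
    (1 : ℝ) ≤ Ideal.absNorm P.asIdeal := by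
  exact_mod_cast Nat.one_le_iff_ne_zero.mpr (Ideal.absNorm_eq_zero_iff.not.mpr P.ne_bot)

theorem sub_sq_le_log_one_add {x : ℝ} (hx : 0 ≤ x) : x - x ^ 2 ≤ Real.log (1 + x) := by
  refine le_trans ?_ (Real.le_log_one_add_of_nonneg hx)
  rw [le_div_iff₀ (by linarith)]
  nlinarith [pow_nonneg hx 2, pow_nonneg hx 3]

theorem log_tprod_le_primeZeta {s : ℝ} (hs : 1 < s) :
    Real.log (∏' P : HeightOneSpectrum (𝓞 F), (1 + (Ideal.absNorm P.asIdeal : ℝ) ^ (-s))) ≤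
      primeZeta F s := by
  have hlog := Real.summable_log_one_add_of_summable (primeZeta_summable (F := F) hs)
  rw [← Real.rexp_tsum_eq_tprod (fun _ ↦ by positivity) hlog, Real.log_exp]
  refine hlog.tsum_le_tsum (fun P ↦ ?_) (primeZeta_summable hs)
  linarith [Real.log_le_sub_one_of_pos
    (show 0 < 1 + (Ideal.absNorm P.asIdeal : ℝ) ^ (-s) by positivity)]

theorem primeZeta_le_log_tprod_add {s : ℝ} (hs : 1 < s) :
    primeZeta F s ≤
      Real.log (∏' P : HeightOneSpectrum (𝓞 F), (1 + (Ideal.absNorm P.asIdeal : ℝ) ^ (-s))) +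
        primeZeta F 2 := by
  have hlog := Real.summable_log_one_add_of_summable (primeZeta_summable (F := F) hs)
  rw [← Real.rexp_tsum_eq_tprod (fun _ ↦ by positivity) hlog, Real.log_exp, primeZeta, primeZeta,
    ← hlog.tsum_add (primeZeta_summable one_lt_two)]
  refine (primeZeta_summable hs).tsum_le_tsum (fun P ↦ ?_)
    (hlog.add (primeZeta_summable one_lt_two))
  have h1 := sub_sq_le_log_one_add
    (show 0 ≤ (Ideal.absNorm P.asIdeal : ℝ) ^ (-s) by positivity)
  have h2 : ((Ideal.absNorm P.asIdeal : ℝ) ^ (-s)) ^ 2 ≤ (Ideal.absNorm P.asIdeal : ℝ) ^ (-2 : ℝ) := by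
    rw [← Real.rpow_natCast, ← Real.rpow_mul (by positivity)]
    exact Real.rpow_le_rpow_of_exponent_le (one_le_absNorm_asIdeal P) (by push_cast; linarith)
  linarith

theorem one_le_idealZeta {s : ℝ} (hs : 1 < s) : 1 ≤ idealZeta F s := by
  simpa [idealZeta] using (summable_absNorm F hs).le_tsum ⊤ (fun _ _ ↦ by positivity)

theorem idealZeta_anti {s t : ℝ} (hs : 1 < s) (hst : s ≤ t) : idealZeta F t ≤ idealZeta F s := by
  refine (summable_absNorm F (hs.trans_le hst)).tsum_le_tsum (fun I ↦ ?_) (summable_absNorm F hs)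
  rcases eq_or_ne I ⊥ with rfl | hI
  · simp [Real.zero_rpow (show -s ≠ 0 by linarith), Real.zero_rpow (show -t ≠ 0 by linarith)]
  · refine Real.rpow_le_rpow_of_exponent_le ?_ (by linarith)
    exact_mod_cast Nat.one_le_iff_ne_zero.mpr (Ideal.absNorm_eq_zero_iff.not.mpr hI)

/-- Both quantities are compared with the logarithm of `∏ (1 + N P ^ (-s))`. What matters is that
the bound does not depend on `s`. -/
theorem abs_primeZeta_sub_log_le {s : ℝ} (hs : 1 < s) :
    |primeZeta F s - Real.log (idealZeta F s)| ≤ Real.log (idealZeta F 2) + primeZeta F 2 := by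
  have hpos : 0 < ∏' P : HeightOneSpectrum (𝓞 F), (1 + (Ideal.absNorm P.asIdeal : ℝ) ^ (-s)) := by
    rw [← Real.rexp_tsum_eq_tprod (fun _ ↦ by positivity)
      (Real.summable_log_one_add_of_summable (primeZeta_summable (F := F) hs))]
    exact Real.exp_pos _
  have h0 := one_le_idealZeta (F := F) hs
  have h2 := one_le_idealZeta (F := F) one_lt_two
  have h2s := one_le_idealZeta (F := F) (s := 2 * s) (by linarith)
  have a := Real.log_le_log hpos (tprod_one_add_le_idealZeta (F := F) hs)
  have b := Real.log_le_log (by linarith) (idealZeta_le_mul_tprod (F := F) hs)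
  rw [Real.log_mul (by linarith) hpos.ne'] at b
  have c := Real.log_le_log (by linarith)
    (idealZeta_anti (F := F) (s := 2) (t := 2 * s) one_lt_two (by linarith))
  have d := log_tprod_le_primeZeta (F := F) hs
  have e := primeZeta_le_log_tprod_add (F := F) hs
  have f : 0 ≤ primeZeta F 2 := tsum_nonneg fun _ ↦ by positivity
  have g := Real.log_nonneg h2
  rw [abs_le]
  constructor <;> linarith

theorem tendsto_neg_log_sub_one :
    Tendsto (fun s : ℝ ↦ -Real.log (s - 1)) (𝓝[>] 1) atTop := by
  rw [tendsto_neg_atTop_iff]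
  refine Real.tendsto_log_nhdsGT_zero.comp ?_
  refine tendsto_nhdsWithin_iff.mpr ⟨?_, ?_⟩
  · have : Tendsto (fun s : ℝ ↦ s - 1) (𝓝 1) (𝓝 (1 - 1)) := (by fun_prop : Continuous _).tendsto _
    rw [sub_self] at this
    exact this.mono_left nhdsWithin_le_nhds
  · filter_upwards [self_mem_nhdsWithin] with s hs
    simpa using hs

theorem tendsto_div_neg_log_of_bounded {f : ℝ → ℝ} {C : ℝ} (h : ∀ s > 1, |f s| ≤ C) :
    Tendsto (fun s ↦ f s / -Real.log (s - 1)) (𝓝[>] 1) (𝓝 0) := by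
  refine tendsto_neg_log_sub_one.inv_tendsto_atTop.zero_mul_isBoundedUnder_le
    (f := fun s ↦ (-Real.log (s - 1))⁻¹) (g := f) ?_ |>.congr fun s ↦ ?_
  · refine isBoundedUnder_of_eventually_le (a := C) ?_
    filter_upwards [self_mem_nhdsWithin] with s hs using h s hs
  · rw [div_eq_mul_inv, mul_comm]

/-- Since `-log (s - 1)` tends to infinity, bounded errors do not affect densities. All later
density computations rest on this. -/
theorem tendsto_div_neg_log_congr {f g : ℝ → ℝ} {C δ : ℝ} (h : ∀ s > 1, |f s - g s| ≤ C)
    (hg : Tendsto (fun s ↦ g s / -Real.log (s - 1)) (𝓝[>] 1) (𝓝 δ)) :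
    Tendsto (fun s ↦ f s / -Real.log (s - 1)) (𝓝[>] 1) (𝓝 δ) := by
  have := (tendsto_div_neg_log_of_bounded h).add hg
  rw [zero_add] at this
  exact this.congr fun s ↦ by ring

-- The pole at `1` is simple with nonzero residue, so `log ζ(s) = -log (s - 1) + O(1)` near `1`.
variable (F) in
theorem tendsto_primeZeta_div :
    Tendsto (fun s ↦ primeZeta F s / -Real.log (s - 1)) (𝓝[>] 1) (𝓝 1) := by
  refine tendsto_div_neg_log_congr (fun s hs ↦ abs_primeZeta_sub_log_le hs) ?_
  have h1 := (tendsto_sub_one_mul_idealZeta F).log (dedekindZeta_residue_ne_zero F)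
  have h2 := h1.mul tendsto_neg_log_sub_one.inv_tendsto_atTop
  rw [mul_zero] at h2
  have h3 := h2.add (tendsto_const_nhds (x := (1 : ℝ)))
  rw [zero_add] at h3
  refine h3.congr' ?_
  filter_upwards [self_mem_nhdsWithin, tendsto_neg_log_sub_one.eventually_gt_atTop 0] with s hs hl
  have hs' : (1 : ℝ) < s := hs
  rw [Real.log_mul (by linarith) (by linarith [one_le_idealZeta (F := F) hs'])]
  simp only [Pi.inv_apply]
  have : Real.log (s - 1) ≠ 0 := by linarith
  field_simp
  ring

end EulerProduct

/-- The ideal of `ℤ` generated by a prime number. -/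
abbrev primeIdeal (p : ℕ) : Ideal ℤ := Ideal.span {(p : ℤ)}

theorem primeIdeal_isMaximal {p : ℕ} (hp : p.Prime) : (primeIdeal p).IsMaximal :=
  have : Fact p.Prime := ⟨hp⟩
  Int.ideal_span_isMaximal_of_prime p

theorem primeIdeal_ne_bot {p : ℕ} (hp : p.Prime) : primeIdeal p ≠ ⊥ := by
  simpa [primeIdeal] using hp.ne_zero

/-! ### Splitting of rational primes in Galois number fields -/

section Galois

variable (F : Type*) [Field F] [NumberField F]

/-- The number of primes of `𝓞 F` above `p`. -/
noncomputable def numPrimesOver (p : ℕ) : ℕ := ((primeIdeal p).primesOver (𝓞 F)).ncard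

/-- The set of rational primes that split completely in `F`. -/
def splitPrimes : Set ℕ := {p | numPrimesOver F p = finrank ℚ F}

variable {F}

theorem numPrimesOver_mul [IsGalois ℚ F] {p : ℕ} (hp : p.Prime) :
    numPrimesOver F p * ((primeIdeal p).ramificationIdxIn (𝓞 F) *
      (primeIdeal p).inertiaDegIn (𝓞 F)) = finrank ℚ F := by
  have := (primeIdeal_isMaximal hp).isPrime
  rw [← IsGalois.card_aut_eq_finrank ℚ F]
  exact Ideal.ncard_primesOver_mul_ramificationIdxIn_mul_inertiaDegIn (primeIdeal p) (𝓞 F)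
    Gal(F/ℚ)

theorem numPrimesOver_pos {p : ℕ} (hp : p.Prime) : 0 < numPrimesOver F p := by
  have := primeIdeal_isMaximal hp
  exact IsDedekindDomain.one_le_primesOver_ncard (primeIdeal p) (𝓞 F)

theorem inertiaDegIn_pos [IsGalois ℚ F] {p : ℕ} (hp : p.Prime) :
    0 < (primeIdeal p).inertiaDegIn (𝓞 F) := by
  have := numPrimesOver_mul (F := F) hp
  have h2 : 0 < finrank ℚ F := finrank_pos
  by_contra! h
  simp_all

theorem numPrimesOver_le [IsGalois ℚ F] {p : ℕ} (hp : p.Prime) :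
    numPrimesOver F p ≤ finrank ℚ F :=
  Nat.le_of_dvd finrank_pos ⟨_, (numPrimesOver_mul hp).symm⟩

theorem inertiaDegIn_eq_one_of_mem_splitPrimes [IsGalois ℚ F] {p : ℕ} (hp : p.Prime)
    (h : p ∈ splitPrimes F) : (primeIdeal p).inertiaDegIn (𝓞 F) = 1 := by
  have h1 := numPrimesOver_mul (F := F) hp
  rw [show numPrimesOver F p = finrank ℚ F from h] at h1
  have := Nat.eq_of_mul_eq_mul_left (finrank_pos (R := ℚ) (M := F)) (h1.trans (mul_one _).symm)
  exact Nat.eq_one_of_mul_eq_one_left this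

theorem numPrimesOver_mul_inertiaDegIn [IsGalois ℚ F] {p : ℕ} (hp : p.Prime)
    (hunr : Algebra.IsUnramifiedIn (𝓞 F) (primeIdeal p)) :
    numPrimesOver F p * (primeIdeal p).inertiaDegIn (𝓞 F) = finrank ℚ F := by
  have := primeIdeal_isMaximal hp
  obtain ⟨⟨P, _, hP⟩⟩ := (inferInstance : Nonempty ((primeIdeal p).primesOver (𝓞 F)))
  rw [← numPrimesOver_mul hp, Ideal.ramificationIdxIn_eq_ramificationIdx (primeIdeal p) P Gal(F/ℚ),
    hunr.ramificationIdx_eq_one hP, one_mul]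

theorem absNorm_eq_pow_inertiaDegIn [IsGalois ℚ F] {p : ℕ} (hp : p.Prime) (P : Ideal (𝓞 F))
    [P.IsPrime] [P.LiesOver (primeIdeal p)] :
    Ideal.absNorm P = p ^ (primeIdeal p).inertiaDegIn (𝓞 F) := by
  have := primeIdeal_isMaximal hp
  rw [Ideal.inertiaDegIn_eq_inertiaDeg (primeIdeal p) P Gal(F/ℚ)]
  exact (Ideal.pow_inertiaDeg p P).symm

/-- Ramified primes divide the discriminant, which is nonzero. -/
theorem finite_ramified (F : Type*) [Field F] [NumberField F] :
    {p : Nat.Primes | ¬ Algebra.IsUnramifiedIn (𝓞 F) (primeIdeal p)}.Finite := by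
  have hfin : {n : ℕ | (n : ℤ) ∣ discr F}.Finite := by
    refine (discr F).natAbs.divisors.finite_toSet.subset fun n hn ↦ ?_
    simpa [discr_ne_zero] using Int.natCast_dvd.mp hn
  refine (hfin.preimage (f := ((↑) : Nat.Primes → ℕ))
    (Subtype.val_injective.injOn)).subset fun p hp ↦ ?_
  by_contra h
  exact hp ((not_dvd_discr_iff_isUnramifiedIn F (𝓞 F) (Nat.prime_iff_prime_int.mp p.2)).mp h)

variable (F) in
/-- The rational prime below a nonzero prime ideal. -/
noncomputable def primeBelow (P : HeightOneSpectrum (𝓞 F)) : Nat.Primes :=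
  ⟨Ideal.absNorm (P.asIdeal.under ℤ),
    have : NeZero P.asIdeal := ⟨P.ne_bot⟩
    Nat.absNorm_under_prime P.asIdeal⟩

instance liesOver_primeBelow (P : HeightOneSpectrum (𝓞 F)) :
    P.asIdeal.LiesOver (primeIdeal (primeBelow F P)) :=
  Int.liesOver_span_absNorm P.asIdeal

theorem primeBelow_eq_iff {F : Type*} [Field F] (P : HeightOneSpectrum (𝓞 F)) (p : Nat.Primes) :
    primeBelow F P = p ↔ P.asIdeal ∈ (primeIdeal p).primesOver (𝓞 F) := by
  refine ⟨fun h ↦ h ▸ ⟨P.isPrime, inferInstance⟩, fun ⟨_, h⟩ ↦ Subtype.ext ?_⟩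
  simp [primeBelow, ← h.over]

/-- The fibers of `primeBelow` are the sets of primes above a rational prime. -/
noncomputable def fiberPrimeBelow (p : Nat.Primes) :
    {P : HeightOneSpectrum (𝓞 F) // primeBelow F P = p} ≃ (primeIdeal p).primesOver (𝓞 F) where
  toFun P := ⟨P.1.asIdeal, (primeBelow_eq_iff _ _).mp P.2⟩
  invFun Q := ⟨⟨Q.1, Q.2.1, Ideal.ne_bot_of_mem_primesOver (primeIdeal_ne_bot p.2) Q.2⟩,
    (primeBelow_eq_iff _ _).mpr Q.2⟩
  left_inv _ := rfl
  right_inv _ := rfl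

/-- Summing a function of the norm over the primes of a Galois number field, by first summing over
the primes above a given rational prime. -/
theorem hasSum_of_hasSum_absNorm [IsGalois ℚ F] {h : ℕ → ℝ} {a : ℝ}
    (H : HasSum (fun P : HeightOneSpectrum (𝓞 F) ↦ h (Ideal.absNorm P.asIdeal)) a) :
    HasSum (fun p : Nat.Primes ↦
      numPrimesOver F p * h ((p : ℕ) ^ (primeIdeal p).inertiaDegIn (𝓞 F))) a := by
  refine ((Equiv.sigmaFiberEquiv (primeBelow F)).hasSum_iff.mpr H).sigma fun p ↦ ?_
  have := primeIdeal_isMaximal p.2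
  have := Fintype.ofEquiv _ (fiberPrimeBelow (F := F) p).symm
  have hs := hasSum_fintype fun P : {P : HeightOneSpectrum (𝓞 F) // primeBelow F P = p} ↦
    h (Ideal.absNorm P.1.asIdeal)
  rw [Finset.sum_congr rfl (g := fun _ ↦ h ((p : ℕ) ^ (primeIdeal p).inertiaDegIn (𝓞 F)))] at hs
  · rw [Finset.sum_const, nsmul_eq_mul, Finset.card_univ, ← Nat.card_eq_fintype_card,
      Nat.card_congr (fiberPrimeBelow p)] at hs
    exact hs
  · rintro ⟨P, rfl⟩ -
    rw [absNorm_eq_pow_inertiaDegIn (primeBelow F P).2]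

end Galois

/-! ### Dirichlet densities, and the density of the split primes -/

section Density

/-- The sum of `p ^ (-s)` over the primes in `S`. -/
noncomputable def primeSum (S : Set ℕ) (s : ℝ) : ℝ :=
  ∑' p : Nat.Primes, S.indicator (fun n ↦ (n : ℝ) ^ (-s)) p

theorem summable_primeSum (S : Set ℕ) {s : ℝ} (hs : 1 < s) :
    Summable fun p : Nat.Primes ↦ S.indicator (fun n ↦ (n : ℝ) ^ (-s)) p := by
  refine Summable.of_nonneg_of_le (fun p ↦ Set.indicator_nonneg (fun _ _ ↦ by positivity) _)
    (fun p ↦ Set.indicator_le_self' (fun _ _ ↦ by positivity) _)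
    (Nat.Primes.summable_rpow.mpr (by linarith))

/-- The lemmas on number fields view `ℚ` as an algebra over itself through
`DivisionRing.toRatAlgebra`, so the statement is transported to that instance. -/
theorem isGalois_rat : @IsGalois ℚ _ ℚ _ DivisionRing.toRatAlgebra := by
  convert! IsGalois.self ℚ

attribute [local instance] isGalois_rat

theorem finrank_rat_rat : @finrank ℚ ℚ _ _ DivisionRing.toRatAlgebra.toModule = 1 := by
  convert! finrank_self ℚ

theorem numPrimesOver_rat {p : ℕ} (hp : p.Prime) : numPrimesOver ℚ p = 1 := by
  have := numPrimesOver_le (F := ℚ) hp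
  rw [finrank_rat_rat] at this
  exact le_antisymm this (numPrimesOver_pos hp)

theorem inertiaDegIn_rat {p : ℕ} (hp : p.Prime) : (primeIdeal p).inertiaDegIn (𝓞 ℚ) = 1 :=
  inertiaDegIn_eq_one_of_mem_splitPrimes hp ((numPrimesOver_rat hp).trans finrank_rat_rat.symm)

theorem primeIdealZetaSum_primeIdealsOf (S : Set ℕ) {s : ℝ} (hs : 1 < s) :
    NumberField.Set.primeIdealZetaSum (primeIdealsOf S) s = primeSum S s := by
  rw [NumberField.Set.primeIdealZetaSum_def,
    tsum_subtype (primeIdealsOf S) fun v ↦ (Ideal.absNorm v.asIdeal : ℝ) ^ (-s)]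
  have h : Summable fun P : HeightOneSpectrum (𝓞 ℚ) ↦
      S.indicator (fun n ↦ (n : ℝ) ^ (-s)) (Ideal.absNorm P.asIdeal) :=
    Summable.of_nonneg_of_le (fun p ↦ Set.indicator_nonneg (fun _ _ ↦ by positivity) _)
      (fun p ↦ Set.indicator_le_self' (fun _ _ ↦ by positivity) _) (primeZeta_summable hs)
  refine Eq.trans ?_ ((hasSum_of_hasSum_absNorm h.hasSum).tsum_eq.symm.trans ?_)
  · exact tsum_congr fun _ ↦ rfl
  · refine tsum_congr fun p ↦ ?_
    rw [numPrimesOver_rat p.2, inertiaDegIn_rat p.2]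
    simp

theorem primeIdealZetaSum_univ (s : ℝ) :
    NumberField.Set.primeIdealZetaSum (Set.univ : Set (HeightOneSpectrum (𝓞 ℚ))) s =
      primeZeta ℚ s := by
  rw [NumberField.Set.primeIdealZetaSum_def, primeZeta]
  exact tsum_univ fun v : HeightOneSpectrum (𝓞 ℚ) ↦ (Ideal.absNorm v.asIdeal : ℝ) ^ (-s)

theorem tendsto_primeSum_univ :
    Tendsto (fun s ↦ primeSum Set.univ s / -Real.log (s - 1)) (𝓝[>] 1) (𝓝 1) := by
  refine (tendsto_primeZeta_div ℚ).congr' ?_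
  filter_upwards [self_mem_nhdsWithin] with s hs
  rw [← primeIdealZetaSum_univ, ← primeIdealZetaSum_primeIdealsOf _ hs]
  rfl

theorem hasDirichletDensity_of_tendsto {S : Set ℕ} {δ : ℝ}
    (h : Tendsto (fun s ↦ primeSum S s / -Real.log (s - 1)) (𝓝[>] 1) (𝓝 δ)) :
    HasDirichletDensity S δ := by
  have := h.div (tendsto_primeZeta_div ℚ) one_ne_zero
  rw [div_one] at this
  refine this.congr' ?_
  filter_upwards [self_mem_nhdsWithin, tendsto_neg_log_sub_one.eventually_gt_atTop 0] with s hs hl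
  rw [Pi.div_apply, div_div_div_cancel_right₀ hl.ne', ← primeIdealZetaSum_univ,
    ← primeIdealZetaSum_primeIdealsOf _ hs]

variable (F : Type*) [Field F] [NumberField F]

/-- The primes that split completely in a Galois number field of degree `n` have density `1/n`. -/
theorem tendsto_primeSum_splitPrimes [IsGalois ℚ F] :
    Tendsto (fun s ↦ primeSum (splitPrimes F) s / -Real.log (s - 1)) (𝓝[>] 1)
      (𝓝 (1 / finrank ℚ F)) := by
  have hn : (0 : ℝ) < finrank ℚ F := by exact_mod_cast finrank_pos (R := ℚ) (M := F)
  set n : ℝ := ((finrank ℚ F : ℕ) : ℝ) with hn_def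
  set R : Set Nat.Primes := {p : Nat.Primes | ¬ Algebra.IsUnramifiedIn (𝓞 F) (primeIdeal p)}
  have hR : Summable (R.indicator fun _ ↦ n) :=
    summable_of_hasFiniteSupport ((finite_ramified F).subset fun p hp ↦ by
      by_contra h
      exact hp (Set.indicator_of_notMem h _))
  have hbd : Summable fun p : Nat.Primes ↦ n * (p : ℝ) ^ (-2 : ℝ) + R.indicator (fun _ ↦ n) p :=
    ((Nat.Primes.summable_rpow.mpr (by norm_num)).mul_left n).add hR
  -- Split primes cancel exactly; an unramified nonsplit prime contributes at most `n * p ^ (-2)`,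
  -- since `f ≥ 2`; each of the finitely many ramified primes contributes at most `n`.
  have key : ∀ s > 1, |n * primeSum (splitPrimes F) s - primeZeta F s| ≤
      ∑' p : Nat.Primes, (n * (p : ℝ) ^ (-2 : ℝ) + R.indicator (fun _ ↦ n) p) := by
    intro s hs
    have H := (hasSum_of_hasSum_absNorm (h := fun k ↦ (k : ℝ) ^ (-s))
      (primeZeta_summable (F := F) hs).hasSum)
    have H2 := ((summable_primeSum (splitPrimes F) hs).hasSum.mul_left n).sub H
    rw [← primeSum, ← primeZeta] at H2
    rw [← Real.norm_eq_abs, ← H2.tsum_eq]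
    refine tsum_of_norm_bounded hbd.hasSum fun p ↦ ?_
    have hp1 : (1 : ℝ) ≤ (p : ℕ) := by exact_mod_cast p.2.one_le
    have hg : (numPrimesOver F p : ℝ) ≤ n := Nat.cast_le.mpr (numPrimesOver_le p.2)
    have hp2 : 0 ≤ n * ((p : ℕ) : ℝ) ^ (-2 : ℝ) := by positivity
    have hR0 : 0 ≤ R.indicator (fun _ ↦ n) p := Set.indicator_nonneg (fun _ _ ↦ hn.le) _
    by_cases hsp : (p : ℕ) ∈ splitPrimes F
    · rw [Set.indicator_of_mem hsp, inertiaDegIn_eq_one_of_mem_splitPrimes p.2 hsp,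
        show numPrimesOver F p = finrank ℚ F from hsp]
      simp only [pow_one, n, sub_self, norm_zero]
      positivity
    rw [Set.indicator_of_notMem hsp, mul_zero, zero_sub, norm_neg, Real.norm_of_nonneg
      (by positivity)]
    by_cases hr : p ∈ R
    · rw [Set.indicator_of_mem hr]
      have : (((p : ℕ) ^ (primeIdeal p).inertiaDegIn (𝓞 F) : ℕ) : ℝ) ^ (-s) ≤ 1 :=
        Real.rpow_le_one_of_one_le_of_nonpos
          (by exact_mod_cast Nat.one_le_pow _ _ p.2.pos) (by linarith)
      nlinarith
    · have hf : 2 ≤ (primeIdeal p).inertiaDegIn (𝓞 F) := by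
        have h1 := inertiaDegIn_pos (F := F) p.2
        by_contra! h
        have h2 : (primeIdeal p).inertiaDegIn (𝓞 F) = 1 := by omega
        have h3 := numPrimesOver_mul_inertiaDegIn (F := F) p.2 (not_not.mp hr)
        rw [h2, mul_one] at h3
        exact hsp h3
      have : (((p : ℕ) ^ (primeIdeal p).inertiaDegIn (𝓞 F) : ℕ) : ℝ) ^ (-s) ≤
          ((p : ℕ) : ℝ) ^ (-2 : ℝ) := by
        rw [Nat.cast_pow, ← Real.rpow_natCast, ← Real.rpow_mul (by positivity)]
        refine Real.rpow_le_rpow_of_exponent_le hp1 ?_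
        have : (2 : ℝ) ≤ (primeIdeal p).inertiaDegIn (𝓞 F) := by exact_mod_cast hf
        nlinarith
      have : (numPrimesOver F p : ℝ) *
          (((p : ℕ) ^ (primeIdeal p).inertiaDegIn (𝓞 F) : ℕ) : ℝ) ^ (-s) ≤
          n * ((p : ℕ) : ℝ) ^ (-2 : ℝ) := by gcongr
      linarith
  have h1 := (tendsto_div_neg_log_congr key (tendsto_primeZeta_div F)).div_const n
  exact h1.congr fun s ↦ by field_simp

/-- If, outside a finite set of primes, the indicator function of `S` is an integral combination of
those of `univ`, `A`, `B`, `C`, then so is its density. -/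
theorem tendsto_primeSum_of_indicator {S A B C : Set ℕ} {c : ℝ} {α β γ : ℝ} {R : Set Nat.Primes}
    (hR : R.Finite)
    (h : ∀ p : Nat.Primes, p ∉ R → ∀ f : ℕ → ℝ, S.indicator f p =
      f p - A.indicator f p - B.indicator f p + c * C.indicator f p)
    (hA : Tendsto (fun s ↦ primeSum A s / -Real.log (s - 1)) (𝓝[>] 1) (𝓝 α))
    (hB : Tendsto (fun s ↦ primeSum B s / -Real.log (s - 1)) (𝓝[>] 1) (𝓝 β))
    (hC : Tendsto (fun s ↦ primeSum C s / -Real.log (s - 1)) (𝓝[>] 1) (𝓝 γ)) :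
    Tendsto (fun s ↦ primeSum S s / -Real.log (s - 1)) (𝓝[>] 1) (𝓝 (1 - α - β + c * γ)) := by
  -- At an exceptional prime the terms for `S`, `univ`, `A` and `B` are each at most `1` in absolute
  -- value, and the one for `C` at most `|c|`.
  have hR' : Summable (R.indicator fun _ ↦ 4 + |c|) :=
    summable_of_hasFiniteSupport (hR.subset fun p hp ↦ by
      by_contra h
      exact hp (Set.indicator_of_notMem h _))
  refine tendsto_div_neg_log_congr (C := ∑' p : Nat.Primes, R.indicator (fun _ ↦ 4 + |c|) p)
    (g := fun s ↦ primeSum Set.univ s - primeSum A s - primeSum B s + c * primeSum C s) ?_ ?_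
  · intro s hs
    have H := (summable_primeSum S hs).hasSum.sub
      (((((summable_primeSum .univ hs).hasSum.sub (summable_primeSum A hs).hasSum)).sub
      (summable_primeSum B hs).hasSum).add ((summable_primeSum C hs).hasSum.mul_left c))
    change HasSum _ (primeSum S s - (primeSum .univ s - primeSum A s - primeSum B s +
      c * primeSum C s)) at H
    rw [← Real.norm_eq_abs, ← H.tsum_eq]
    refine tsum_of_norm_bounded hR'.hasSum fun p ↦ ?_
    by_cases hp : p ∈ R
    · rw [Set.indicator_of_mem hp]
      have hx : |((p : ℕ) : ℝ) ^ (-s)| ≤ 1 := by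
        rw [abs_of_nonneg (by positivity)]
        exact Real.rpow_le_one_of_one_le_of_nonpos (by exact_mod_cast p.2.one_le) (by linarith)
      have hi (T : Set ℕ) : ‖T.indicator (fun n ↦ (n : ℝ) ^ (-s)) (p : ℕ)‖ ≤ 1 :=
        (norm_indicator_le_norm_self _ _).trans hx
      have hc : ‖c * C.indicator (fun n ↦ (n : ℝ) ^ (-s)) (p : ℕ)‖ ≤ |c| := by
        rw [norm_mul]
        exact mul_le_of_le_one_right (abs_nonneg c) (hi C)
      obtain ⟨s1, s2⟩ := abs_le.mp (hi S)
      obtain ⟨a1, a2⟩ := abs_le.mp (hi A)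
      obtain ⟨b1, b2⟩ := abs_le.mp (hi B)
      obtain ⟨u1, u2⟩ := abs_le.mp (hi .univ)
      obtain ⟨c1, c2⟩ := abs_le.mp hc
      rw [Real.norm_eq_abs, abs_le]
      constructor <;> linarith
    · rw [Set.indicator_of_notMem hp, h p hp]
      simp
  · refine (((tendsto_primeSum_univ.sub hA).sub hB).add (hC.const_mul c)).congr fun s ↦ ?_
    ring

end Density

/-! ### Arithmetic types in Galois fields -/

section ArithmeticType

variable {F : Type*} [Field F] [NumberField F] [IsGalois ℚ F]

/-- The Galois group permutes the primes above `p` transitively, so their residue degrees agree. -/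
theorem arithmeticType_eq_replicate {p : ℕ} (hp : p.Prime) :
    arithmeticType F p =
      List.replicate (numPrimesOver F p) ((primeIdeal p).inertiaDegIn (𝓞 F)) := by
  have := primeIdeal_isMaximal hp
  have h0 := primeIdeal_ne_bot hp
  have h1 : (IsDedekindDomain.primesOverFinset (primeIdeal p) (𝓞 F)).val.map
      (fun P ↦ P.inertiaDeg ℤ) =
      Multiset.replicate (numPrimesOver F p) ((primeIdeal p).inertiaDegIn (𝓞 F)) := by
    rw [Multiset.eq_replicate]
    refine ⟨?_, fun b hb ↦ ?_⟩
    · rw [Multiset.card_map, Finset.card_val, numPrimesOver, ← IsDedekindDomain.coe_primesOverFinset h0 (𝓞 F),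
        Set.ncard_coe_finset]
    · obtain ⟨P, hP, rfl⟩ := Multiset.mem_map.mp hb
      obtain ⟨_, _⟩ := (IsDedekindDomain.mem_primesOverFinset_iff h0 (𝓞 F)).mp hP
      exact (Ideal.inertiaDegIn_eq_inertiaDeg (primeIdeal p) P Gal(F/ℚ)).symm
  rw [arithmeticType, h1, ← Multiset.coe_replicate, Multiset.coe_sort]
  exact List.mergeSort_eq_self _ (List.pairwise_replicate.mpr (by simp))

/-- For unramified `p`, `g * f = n`, so `g` determines `f`. -/
theorem arithmeticType_eq_iff {L : Type*} [Field L] [NumberField L] [IsGalois ℚ L]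
    (hFL : finrank ℚ F = finrank ℚ L) {p : ℕ} (hp : p.Prime)
    (hF : Algebra.IsUnramifiedIn (𝓞 F) (primeIdeal p))
    (hL : Algebra.IsUnramifiedIn (𝓞 L) (primeIdeal p)) :
    arithmeticType F p = arithmeticType L p ↔ numPrimesOver F p = numPrimesOver L p := by
  rw [arithmeticType_eq_replicate hp, arithmeticType_eq_replicate hp]
  refine ⟨fun h ↦ by simpa using congrArg List.length h, fun h ↦ ?_⟩
  have h1 := numPrimesOver_mul_inertiaDegIn hp hF
  rw [hFL, ← numPrimesOver_mul_inertiaDegIn hp hL, h] at h1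
  rw [h, Nat.eq_of_mul_eq_mul_left (numPrimesOver_pos hp) h1]

/-- An unramified prime splits completely in a Galois number field if and only if it is the norm of
an ideal. -/
theorem mem_splitPrimes_iff_idealCount {p : ℕ} (hp : p.Prime)
    (hF : Algebra.IsUnramifiedIn (𝓞 F) (primeIdeal p)) :
    p ∈ splitPrimes F ↔ idealCount F p ≠ 0 := by
  have := primeIdeal_isMaximal hp
  have : Finite {I : Ideal (𝓞 F) // Ideal.absNorm I = p} := Ideal.finite_setOfPred_absNorm_eq p
  rw [idealCount, Nat.card_ne_zero]
  constructor
  · intro h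
    obtain ⟨⟨P, _, hP⟩⟩ := (inferInstance : Nonempty ((primeIdeal p).primesOver (𝓞 F)))
    refine ⟨⟨P, ?_⟩, this⟩
    rw [absNorm_eq_pow_inertiaDegIn hp, inertiaDegIn_eq_one_of_mem_splitPrimes hp h, pow_one]
  · rintro ⟨⟨P, hP⟩, -⟩
    have : P.IsPrime := Ideal.isPrime_of_irreducible_absNorm (by rwa [hP])
    have : P.LiesOver (primeIdeal p) := by
      refine ⟨(primeIdeal_isMaximal hp).eq_of_le (Ideal.IsPrime.under ℤ P).ne_top ?_⟩
      rw [Ideal.span_singleton_le_iff_mem, Ideal.mem_comap]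
      simpa [hP] using Ideal.absNorm_mem P
    have h1 := absNorm_eq_pow_inertiaDegIn hp P
    rw [hP] at h1
    have h2 : (primeIdeal p).inertiaDegIn (𝓞 F) = 1 :=
      Nat.pow_right_injective hp.two_le (h1.symm.trans (pow_one p).symm)
    have h3 := numPrimesOver_mul_inertiaDegIn hp hF
    rwa [h2, mul_one] at h3

end ArithmeticType

/-! ### The zeta function and its coefficients -/

section Zeta

variable {K L : Type*} [Field K] [NumberField K] [Field L] [NumberField L]

theorem idealCount_congr (e : K ≃+* L) (n : ℕ) : idealCount K n = idealCount L n := by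
  let e' : 𝓞 K ≃+* 𝓞 L := RingOfIntegers.mapRingEquiv e
  refine Nat.card_congr (e'.idealComapOrderIso.symm.toEquiv.subtypeEquiv fun I ↦ ?_)
  have : Ideal.absNorm I = Ideal.absNorm (I.map e') := by
    rw [Ideal.absNorm_apply, Ideal.absNorm_apply, Submodule.cardQuot_apply,
      Submodule.cardQuot_apply]
    exact Nat.card_congr (Ideal.quotientEquiv I (I.map e') e' rfl).toEquiv
  rw [this]
  rfl

theorem ArithmeticallyEquivalent.of_ringEquiv (e : K ≃+* L) : ArithmeticallyEquivalent K L := by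
  intro s _
  exact congrArg (fun a : ℕ → ℕ ↦ LSeries (fun n ↦ (a n : ℂ)) s) (funext (idealCount_congr e))

theorem abscissaOfAbsConv_idealCount_lt_top (F : Type*) [Field F] [NumberField F] :
    LSeries.abscissaOfAbsConv (fun n ↦ (idealCount F n : ℂ)) < ⊤ := by
  refine (LSeriesSummable.abscissaOfAbsConv_le (s := 2)
    (lseriesSummable_idealCount F (by simp))).trans_lt ?_
  exact EReal.coe_lt_top _

/-- Uniqueness of Dirichlet coefficients; the coefficient at `0` is invisible to the series. -/
theorem ArithmeticallyEquivalent.idealCount_eq (h : ArithmeticallyEquivalent K L) {n : ℕ}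
    (hn : n ≠ 0) : idealCount K n = idealCount L n := by
  have := LSeries.eq_of_LSeries_eventually_eq (abscissaOfAbsConv_idealCount_lt_top K)
    (abscissaOfAbsConv_idealCount_lt_top L) ?_ hn
  · exact_mod_cast this
  · filter_upwards [eventually_gt_atTop 1] with s hs
    exact h s (by simpa)

end Zeta

/-! ### Decomposition groups and splitting in a compositum -/

section Compositum

variable {F M : Type*} [Field F] [NumberField F] [IsGalois ℚ F]
  [Field M] [NumberField M] [IsGalois ℚ M] [Algebra F M]

open MulAction
open scoped Pointwise

theorem index_stabilizer_eq_numPrimesOver {p : ℕ} (P : Ideal (𝓞 F)) [P.IsPrime]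
    [P.LiesOver (primeIdeal p)] : (stabilizer Gal(F/ℚ) P).index = numPrimesOver F p := by
  rw [index_stabilizer, numPrimesOver,
    Algebra.IsInvariant.orbit_eq_primesOver ℤ (𝓞 F) Gal(F/ℚ) (primeIdeal p) P]

/-- The decomposition group has index `g`, so it is trivial exactly when `g = n`. -/
theorem mem_splitPrimes_iff_stabilizer {p : ℕ} (P : Ideal (𝓞 F)) [P.IsPrime]
    [P.LiesOver (primeIdeal p)] : p ∈ splitPrimes F ↔ stabilizer Gal(F/ℚ) P = ⊥ := by
  rw [splitPrimes, Set.mem_ofPred_eq, ← index_stabilizer_eq_numPrimesOver P,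
    ← IsGalois.card_aut_eq_finrank ℚ F]
  refine ⟨fun h ↦ ?_, fun h ↦ by rw [h, Subgroup.index_bot]⟩
  have h1 := (stabilizer Gal(F/ℚ) P).card_mul_index
  rw [h] at h1
  exact Subgroup.eq_bot_of_card_eq _ (Nat.eq_of_mul_eq_mul_right Nat.card_pos
    (h1.trans (one_mul _).symm))

/-- The number of primes is multiplicative in the tower and bounded by the degree at each level, so
equality at the top forces equality below. -/
theorem mem_splitPrimes_of_tower {p : ℕ} (hp : p.Prime) (h : p ∈ splitPrimes M) :
    p ∈ splitPrimes F := by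
  have := primeIdeal_isMaximal hp
  have : IsScalarTower ℚ F M := inferInstance
  have : IsGalois F M := IsGalois.tower_top_of_isGalois ℚ F M
  obtain ⟨⟨P, _, hP⟩⟩ := (inferInstance : Nonempty ((primeIdeal p).primesOver (𝓞 F)))
  have h1 : numPrimesOver F p * (P.primesOver (𝓞 M)).ncard = numPrimesOver M p :=
    Ideal.ncard_primesOver_mul_ncard_primesOver P Gal(F/ℚ) (𝓞 M) Gal(M/ℚ)
  have h2 : (P.primesOver (𝓞 M)).ncard ≤ finrank F M := by
    rw [← IsGalois.card_aut_eq_finrank F M,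
      ← Ideal.ncard_primesOver_mul_ramificationIdxIn_mul_inertiaDegIn P (𝓞 M) Gal(M/F)]
    refine Nat.le_mul_of_pos_right _ (Nat.pos_of_ne_zero (mul_ne_zero ?_ ?_))
    · exact Ideal.ramificationIdxIn_ne_zero Gal(M/F)
    · exact Ideal.inertiaDegIn_ne_zero Gal(M/F)
  have h3 : numPrimesOver M p = finrank ℚ M := h
  rw [h3, ← finrank_mul_finrank ℚ F M] at h1
  have h4 := numPrimesOver_le (F := F) hp
  have h5 : 0 < finrank F M := finrank_pos
  refine le_antisymm h4 ?_
  by_contra! h6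
  nlinarith

/-- Restriction to `F` sends the decomposition group of `P` into that of the prime below, which is
trivial. -/
theorem fixes_of_mem_stabilizer {p : ℕ} (h : p ∈ splitPrimes F)
    (P : Ideal (𝓞 M)) [P.IsPrime] [P.LiesOver (primeIdeal p)] {σ : Gal(M/ℚ)}
    (hσ : σ ∈ stabilizer Gal(M/ℚ) P) (x : F) : σ (algebraMap F M x) = algebraMap F M x := by
  have hP : (P.under (𝓞 F)).LiesOver (primeIdeal p) := by
    refine ⟨?_⟩
    rw [Ideal.under_under]
    exact Ideal.over_def P _
  have hbot := (mem_splitPrimes_iff_stabilizer (P.under (𝓞 F))).mp h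
  have hτ : IsGaloisGroup.restrictHom Gal(M/ℚ) Gal(F/ℚ) ℤ (𝓞 F) (𝓞 M) σ ∈
      stabilizer Gal(F/ℚ) (P.under (𝓞 F)) := by
    rw [mem_stabilizer_iff, IsGaloisGroup.restrictHom_smul_under, mem_stabilizer_iff.mp hσ]
  rw [hbot, Subgroup.mem_bot] at hτ
  have key (y : 𝓞 F) : σ (algebraMap F M y) = algebraMap F M y := by
    have := IsGaloisGroup.algebraMap_restrictHom_smul Gal(M/ℚ) Gal(F/ℚ) ℤ (𝓞 F) (𝓞 M) σ y
    rw [hτ, one_smul] at this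
    exact (congrArg (algebraMap (𝓞 M) M) this).symm
  obtain ⟨a, b, -, rfl⟩ := IsFractionRing.div_surjective (A := 𝓞 F) x
  simp only [map_div₀]
  rw [key, key]

/-- A prime splits completely in a compositum if and only if it does so in both factors. -/
theorem mem_splitPrimes_compositum_iff {L : Type*} [Field L] [NumberField L] [IsGalois ℚ L]
    [Algebra L M] (hsup : (algebraMap F M).toRatAlgHom.fieldRange ⊔
      (algebraMap L M).toRatAlgHom.fieldRange = ⊤) {p : ℕ} (hp : p.Prime) :
    p ∈ splitPrimes M ↔ p ∈ splitPrimes F ∧ p ∈ splitPrimes L := by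
  refine ⟨fun h ↦ ⟨mem_splitPrimes_of_tower hp h, mem_splitPrimes_of_tower hp h⟩, fun ⟨hF, hL⟩ ↦ ?_⟩
  have := primeIdeal_isMaximal hp
  obtain ⟨⟨P, _, hP⟩⟩ := (inferInstance : Nonempty ((primeIdeal p).primesOver (𝓞 M)))
  rw [mem_splitPrimes_iff_stabilizer P, eq_bot_iff]
  intro σ hσ
  -- The fixed field of `σ` contains the images of both factors, hence all of `M`.
  have h1 : (⊤ : IntermediateField ℚ M) ≤ IntermediateField.fixedField (Subgroup.zpowers σ) := by
    rw [← hsup, sup_le_iff]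
    constructor
    all_goals
      rintro _ ⟨x, rfl⟩
      rw [IntermediateField.mem_fixedField_iff]
      intro τ hτ
      obtain ⟨k, rfl⟩ := Subgroup.mem_zpowers_iff.mp hτ
      exact fixes_of_mem_stabilizer (by assumption) P
        (Subgroup.zpow_mem (stabilizer Gal(M/ℚ) P) hσ k) x
  rw [Subgroup.mem_bot]
  ext x
  exact (IntermediateField.mem_fixedField_iff _ _).mp (h1 IntermediateField.mem_top) σ
    (Subgroup.mem_zpowers σ)

end Compositum

/-! ### Degree of the compositum -/

section Existence

/-- Two Galois extensions of the same prime degree `ℓ` have a compositum which is Galois, and of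
degree at least `ℓ ^ 2` unless the extensions are isomorphic. -/
theorem exists_galois_compositum {ℓ : ℕ} (hℓ : ℓ.Prime) (k : Type u) (K L : Type*) [Field k]
    [CharZero k] [Field K] [Field L] [Algebra k K] [Algebra k L] [IsGalois k K] [IsGalois k L]
    (hK : finrank k K = ℓ) (hL : finrank k L = ℓ) :
    ∃ (M : Type u) (_ : Field M) (_ : CharZero M) (_ : Algebra k M) (f : K →ₐ[k] M)
      (g : L →ₐ[k] M), IsGalois k M ∧ FiniteDimensional k M ∧
      f.fieldRange ⊔ g.fieldRange = ⊤ ∧ (finrank k M < ℓ ^ 2 → Nonempty (K ≃ₐ[k] L)) := by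
  have : FiniteDimensional k K := .of_finrank_pos (hK ▸ hℓ.pos)
  have : FiniteDimensional k L := .of_finrank_pos (hL ▸ hℓ.pos)
  let f : K →ₐ[k] AlgebraicClosure k := IsAlgClosed.lift
  let g : L →ₐ[k] AlgebraicClosure k := IsAlgClosed.lift
  let eK : K ≃ₐ[k] f.fieldRange := AlgEquiv.ofInjectiveField f
  let eL : L ≃ₐ[k] g.fieldRange := AlgEquiv.ofInjectiveField g
  have : IsGalois k f.fieldRange := .of_algEquiv eK
  have : IsGalois k g.fieldRange := .of_algEquiv eL
  have : FiniteDimensional k f.fieldRange := .of_surjective eK.toLinearMap eK.surjective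
  have : FiniteDimensional k g.fieldRange := .of_surjective eL.toLinearMap eL.surjective
  let M := f.fieldRange ⊔ g.fieldRange
  have : Normal k M := IntermediateField.normal_sup _ _ _ _
  let iK : K →ₐ[k] M := (IntermediateField.inclusion le_sup_left).comp eK.toAlgHom
  let iL : L →ₐ[k] M := (IntermediateField.inclusion le_sup_right).comp eL.toAlgHom
  refine ⟨M, inferInstance, charZero_of_injective_algebraMap (algebraMap k M).injective,
    inferInstance, iK, iL, ⟨⟩, IntermediateField.finiteDimensional_sup _ _, ?_, fun hlt ↦ ?_⟩
  · apply IntermediateField.map_injective M.val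
    rw [IntermediateField.map_sup, AlgHom.map_fieldRange, AlgHom.map_fieldRange,
      ← AlgHom.fieldRange_eq_map, IntermediateField.fieldRange_val]
    rfl
  · have hfK : finrank k f.fieldRange = ℓ := by rw [← hK, eK.toLinearEquiv.finrank_eq]
    have hfL : finrank k g.fieldRange = ℓ := by rw [← hL, eL.toLinearEquiv.finrank_eq]
    -- Galois extensions with trivial intersection are linearly disjoint, which would give degree `ℓ
    -- ^ 2`.
    have hinf : f.fieldRange ⊓ g.fieldRange ≠ ⊥ := by
      intro h
      have := (IntermediateField.LinearDisjoint.of_inf_eq_bot h).finrank_sup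
      rw [hfK, hfL, ← sq] at this
      exact hlt.ne this
    -- As `ℓ` is prime, a nontrivial subfield of `A` is all of `A`; so both images equal their
    -- intersection.
    have key (A : IntermediateField k (AlgebraicClosure k)) (hA : finrank k A = ℓ)
        (hle : f.fieldRange ⊓ g.fieldRange ≤ A) : f.fieldRange ⊓ g.fieldRange = A := by
      have : FiniteDimensional k A := .of_finrank_pos (hA ▸ hℓ.pos)
      have hd := Dvd.intro _ (IntermediateField.finrank_bot_mul_relfinrank hle)
      rw [hA, Nat.dvd_prime hℓ, IntermediateField.finrank_eq_one_iff] at hd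
      exact IntermediateField.eq_of_le_of_finrank_eq hle ((hd.resolve_left hinf).trans hA.symm)
    exact ⟨eK.trans ((IntermediateField.equivOfEq
      ((key _ hfK inf_le_left).symm.trans (key _ hfL inf_le_right))).trans eL.symm)⟩

/-- The primes that split completely in two Galois number fields of the same prime degree `ℓ` have
density `1 / m` for some `m`, and `m` is at least `ℓ ^ 2` unless the fields are isomorphic. -/
theorem exists_tendsto_primeSum_inter {ℓ : ℕ} (hℓ : ℓ.Prime) (K L : Type*) [Field K]
    [NumberField K] [Field L] [NumberField L] [IsGalois ℚ K] [IsGalois ℚ L]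
    (hK : finrank ℚ K = ℓ) (hL : finrank ℚ L = ℓ) :
    ∃ m : ℕ, (m < ℓ ^ 2 → Nonempty (K ≃+* L)) ∧
      Tendsto (fun s ↦ primeSum (splitPrimes K ∩ splitPrimes L) s / -Real.log (s - 1)) (𝓝[>] 1)
        (𝓝 (1 / m)) := by
  obtain ⟨M, _, _, inst, f, g, hM, hfin, hsup, hlt⟩ := exists_galois_compositum hℓ ℚ K L hK hL
  obtain rfl : inst = DivisionRing.toRatAlgebra := Subsingleton.elim _ _
  have : NumberField M := ⟨⟩
  let : Algebra K M := f.toRingHom.toAlgebra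
  let : Algebra L M := g.toRingHom.toAlgebra
  refine ⟨finrank ℚ M, fun h ↦ (hlt h).map AlgEquiv.toRingEquiv,
    (tendsto_primeSum_splitPrimes M).congr fun s ↦ ?_⟩
  rw [primeSum, primeSum]
  congr 1
  refine tsum_congr fun p ↦ ?_
  classical
  rw [Set.indicator_apply, Set.indicator_apply]
  exact if_congr (mem_splitPrimes_compositum_iff hsup p.2) rfl rfl

end Existence

/-! ### The density of `A_{K,L}` -/

/-- The rational primes that ramify in `K` or in `L`. -/
def ramifiedPrimes (K L : Type*) [Field K] [NumberField K] [Field L] [NumberField L] :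
    Set Nat.Primes :=
  {p | ¬ Algebra.IsUnramifiedIn (𝓞 K) (primeIdeal p)} ∪
    {p | ¬ Algebra.IsUnramifiedIn (𝓞 L) (primeIdeal p)}

theorem ramifiedPrimes_finite (K L : Type*) [Field K] [NumberField K] [Field L] [NumberField L] :
    (ramifiedPrimes K L).Finite :=
  (finite_ramified K).union (finite_ramified L)

variable {K L : Type*} [Field K] [NumberField K] [Field L] [NumberField L]
  [IsGalois ℚ K] [IsGalois ℚ L]

theorem numPrimesOver_eq_one_or {ℓ : ℕ} (hℓ : ℓ.Prime) (hK : finrank ℚ K = ℓ) {p : ℕ}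
    (hp : p.Prime) : numPrimesOver K p = 1 ∨ numPrimesOver K p = ℓ := by
  rw [← Nat.dvd_prime hℓ, ← hK]
  exact ⟨_, (numPrimesOver_mul hp).symm⟩

/-- In prime degree, an unramified prime has the same arithmetic type in both fields if and only if
it splits completely in both or in neither. -/
theorem mem_sameTypePrimes_iff {ℓ : ℕ} (hℓ : ℓ.Prime) (hK : finrank ℚ K = ℓ)
    (hL : finrank ℚ L = ℓ) {p : Nat.Primes} (hp : p ∉ ramifiedPrimes K L) :
    (p : ℕ) ∈ sameTypePrimes K L ↔ ((p : ℕ) ∈ splitPrimes K ↔ (p : ℕ) ∈ splitPrimes L) := by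
  simp only [ramifiedPrimes, Set.mem_union, Set.mem_ofPred_eq, not_or, not_not] at hp
  have h1 : (p : ℕ) ∈ sameTypePrimes K L ↔ numPrimesOver K p = numPrimesOver L p := by
    rw [← arithmeticType_eq_iff (hK.trans hL.symm) p.2 hp.1 hp.2]
    exact ⟨fun h ↦ h.2.1, fun h ↦ ⟨p.2, h, hp⟩⟩
  rw [h1, splitPrimes, splitPrimes, Set.mem_ofPred_eq, Set.mem_ofPred_eq, hK, hL]
  have := hℓ.one_lt
  rcases numPrimesOver_eq_one_or hℓ hK p.2 with h | h <;>
    rcases numPrimesOver_eq_one_or hℓ hL p.2 with h' | h' <;> rw [h, h'] <;> grind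

/-- The density of `A_{K,L}` is `1 - 2/ℓ + 2γ`, where `γ` is the density of the set of primes that
split completely in both fields. -/
theorem tendsto_primeSum_sameTypePrimes {ℓ : ℕ} (hℓ : ℓ.Prime) (hK : finrank ℚ K = ℓ)
    (hL : finrank ℚ L = ℓ) {γ : ℝ}
    (hγ : Tendsto (fun s ↦ primeSum (splitPrimes K ∩ splitPrimes L) s / -Real.log (s - 1)) (𝓝[>] 1)
      (𝓝 γ)) :
    HasDirichletDensity (sameTypePrimes K L) (1 - 1 / ℓ - 1 / ℓ + 2 * γ) := by
  have hA := tendsto_primeSum_splitPrimes K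
  have hB := tendsto_primeSum_splitPrimes L
  rw [hK] at hA
  rw [hL] at hB
  refine hasDirichletDensity_of_tendsto
    (tendsto_primeSum_of_indicator (ramifiedPrimes_finite K L) (fun p hp f ↦ ?_) hA hB hγ)
  classical
  -- Inclusion-exclusion for "both or neither": `1 - 1_K - 1_L + 2 * 1_{K ∩ L}`.
  simp only [Set.indicator_apply, mem_sameTypePrimes_iff hℓ hK hL hp, Set.mem_inter_iff]
  by_cases h : (p : ℕ) ∈ splitPrimes K <;> by_cases h' : (p : ℕ) ∈ splitPrimes L <;>
    simp [h, h'] <;> ring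

/-- For arithmetically equivalent fields, `A_{K,L}` has density one. -/
theorem ArithmeticallyEquivalent.hasDirichletDensity_one {ℓ : ℕ} (hℓ : ℓ.Prime)
    (hK : finrank ℚ K = ℓ) (hL : finrank ℚ L = ℓ) (h : ArithmeticallyEquivalent K L) :
    HasDirichletDensity (sameTypePrimes K L) 1 := by
  have hA := tendsto_primeSum_splitPrimes K
  -- Taking all three sets to be `splitPrimes K` and `c = 2`, the correction terms cancel and the
  -- density is `1`.
  have := tendsto_primeSum_of_indicator (S := sameTypePrimes K L) (c := 2)
    (ramifiedPrimes_finite K L) (fun p hp f ↦ ?_) hA hA hA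
  · refine hasDirichletDensity_of_tendsto ?_
    convert this using 2
    ring
  · have hp' := hp
    simp only [ramifiedPrimes, Set.mem_union, Set.mem_ofPred_eq, not_or, not_not] at hp'
    -- Splitting at an unramified `p` is detected by the `p`-th zeta coefficient, which the two
    -- fields share.
    have hmem : (p : ℕ) ∈ sameTypePrimes K L := by
      rw [mem_sameTypePrimes_iff hℓ hK hL hp, mem_splitPrimes_iff_idealCount p.2 hp'.1,
        mem_splitPrimes_iff_idealCount p.2 hp'.2, h.idealCount_eq p.2.ne_zero]
    rw [Set.indicator_of_mem hmem]
    ring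

end ArithEquiv

theorem theorem3p5 (ℓ : ℕ) (hℓ : ℓ.Prime)
    (K L : Type*) [Field K] [NumberField K] [Field L] [NumberField L]
    [IsGalois ℚ K] [IsGalois ℚ L]
    (hK : Module.finrank ℚ K = ℓ) (hL : Module.finrank ℚ L = ℓ) :
    (∃ δ : ℝ, ArithEquiv.HasDirichletDensity (ArithEquiv.sameTypePrimes K L) δ) ∧
    ∀ δ : ℝ, ArithEquiv.HasDirichletDensity (ArithEquiv.sameTypePrimes K L) δ →
      (1 - 2 / (ℓ : ℝ) ^ 2 < δ → ArithEquiv.ArithmeticallyEquivalent K L) ∧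
      (ℓ = 2 → δ = 1 / 2 → ¬ ArithEquiv.ArithmeticallyEquivalent K L) := by
  obtain ⟨m, hm, hγ⟩ := ArithEquiv.exists_tendsto_primeSum_inter hℓ K L hK hL
  have hd := ArithEquiv.tendsto_primeSum_sameTypePrimes hℓ hK hL hγ
  refine ⟨⟨_, hd⟩, fun δ hδ ↦ ⟨fun hlt ↦ ?_, fun _ hhalf he ↦ ?_⟩⟩
  · rw [tendsto_nhds_unique hδ hd] at hlt
    have hℓ2 : (2 : ℝ) ≤ ℓ := by exact_mod_cast hℓ.two_le
    obtain ⟨e⟩ : Nonempty (K ≃+* L) := hm <| by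
      -- If `m ≥ ℓ²`, the density is at most `1 - 2/ℓ + 2/ℓ²`, and `2/ℓ ≥ 4/ℓ²` since `ℓ ≥ 2`; this
      -- contradicts `hlt`.
      by_contra! hle
      have h1 : (1 : ℝ) / m ≤ 1 / (ℓ : ℝ) ^ 2 :=
        one_div_le_one_div_of_le (by positivity) (by exact_mod_cast hle)
      have h2 : 2 * (1 / (ℓ : ℝ) ^ 2) ≤ 1 / ℓ := by
        rw [mul_one_div, div_le_div_iff₀ (by positivity) (by positivity)]
        nlinarith
      have h3 : 2 / (ℓ : ℝ) ^ 2 = 2 * (1 / (ℓ : ℝ) ^ 2) := by ring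
      linarith
    exact .of_ringEquiv e
  · have := tendsto_nhds_unique hδ (he.hasDirichletDensity_one hℓ hK hL)
    norm_num [hhalf] at this
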